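/- For a ring $S$ with identity let $J(S)$ be its Jacobson radical, and put $J^{\#}(S)=\{x\in S : x^n\in J(S)\text{ for some integer } n\ge 1\}$. An element $a\in S$ is called strongly $J^{\#}$-clean if there is an idempotent $e\in S$ with $a-e\in J^{\#}(S)$ and $ea=ae$. A commutative ring $R$ is projective-free if every finitely generated projective $R$-module is free. Let $R$ be a projective-free commutative ring, let $m\ge 1$ be an integer, and let $A(x)=(a_{ij}(x))\in M_2\big(R[[x]]/(x^m)\big)$. Write $A(0)=(a_{ij}(0))\in M_2(R)$ for the matrix obtained by applying entrywise the ring homomorphism $R[[x]]/(x^m)\to R$ that sends the class of a power series $f$ to its constant term $f(0)$. Then the following are equivalent: (1) $A(x)$ is strongly $J^{\#}$-clean in $M_2\big(R[[x]]/(x^m)\big)$; (2) $A(0)$ is strongly $J^{\#}$-clean in $M_2(R)$. -/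

import Mathlib

universe u

namespace JSharp

/-- The set of elements of a (not necessarily commutative) ring having a positive power in the
Jacobson radical. -/
def jsharp (S : Type u) [Ring S] : Set S :=
  {x | ∃ n : ℕ, 1 ≤ n ∧ x ^ n ∈ Ring.jacobson S}

/-- `a` is strongly `J^#`-clean: there is an idempotent `e` with `a - e ∈ J^#(S)` and
`e * a = a * e`. -/
def IsStronglyJSharpClean {S : Type u} [Ring S] (a : S) : Prop :=
  ∃ e : S, IsIdempotentElem e ∧ a - e ∈ jsharp S ∧ e * a = a * e

/-- A commutative ring is projective-free if every finitely generated projective module over it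
is free. (Finitely generated modules all have a copy in the universe of `R`.) -/
def IsProjectiveFree (R : Type u) [CommRing R] : Prop :=
  ∀ (P : Type u) [AddCommGroup P] [Module R P],
    Module.Finite R P → Module.Projective R P → Module.Free R P

/-- The ring `R[[x]]/(x^m)`. -/
abbrev TruncPowerSeries (R : Type u) [CommRing R] (m : ℕ) : Type u :=
  PowerSeries R ⧸ Ideal.span {(PowerSeries.X : PowerSeries R) ^ m}

/-- Evaluation at `0`, that is `f + (x^m) ↦ f(0)`, as a ring homomorphism `R[[x]]/(x^m) → R`
for `m ≥ 1`. -/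
noncomputable def evalZero (R : Type u) [CommRing R] (m : ℕ) (hm : 1 ≤ m) :
    TruncPowerSeries R m →+* R :=
  Ideal.Quotient.lift (Ideal.span {(PowerSeries.X : PowerSeries R) ^ m})
    (PowerSeries.constantCoeff (R := R)) (by
      intro f hf
      obtain ⟨g, rfl⟩ := Ideal.mem_span_singleton.1 hf
      simp [Nat.one_le_iff_ne_zero.1 hm])

end JSharp

/-! Evaluation at `0` is surjective with nil kernel, so membership in `J` and in `J^#` can be tested
after evaluating; only lifting the commuting idempotent `E` needs work. Projective-freeness enters
through the triviality of idempotents of `R`: `E` is `0`, `1` or of rank one. In the last case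
`A(0)` acts by scalars on the ranges of `E` and `1 - E`, so its characteristic polynomial has roots
in `1 + J` and `J`. Their difference is a unit, so Newton's method lifts the root in `1 + J`, and
the lifted roots define a spectral idempotent that commutes with `A(x)`. -/

namespace JSharp

/-- A projective-free commutative ring has only trivial idempotents. -/
theorem IsProjectiveFree.eq_zero_or_eq_one {R : Type u} [CommRing R] (hR : IsProjectiveFree R)
    {e : R} (he : IsIdempotentElem e) : e = 0 ∨ e = 1 := by
  rcases subsingleton_or_nontrivial R with _ | _
  · exact Or.inl (Subsingleton.elim _ _)
  have key : ∀ y ∈ Submodule.span R {e}, e * y = y := by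
    intro y hy
    obtain ⟨r, rfl⟩ := Submodule.mem_span_singleton.1 hy
    rw [smul_eq_mul, mul_left_comm, he.eq]
  have hproj : Module.Projective R (Submodule.span R {e}) := by
    refine Module.Projective.of_split (Submodule.span R {e}).subtype
      ((LinearMap.toSpanSingleton R R e).codRestrict _ fun r =>
        Submodule.mem_span_singleton.2 ⟨r, rfl⟩) ?_
    ext y
    simpa [mul_comm] using key y y.2
  have hfree := hR (Submodule.span R {e}) inferInstance hproj
  have b := Module.Free.chooseBasis R (Submodule.span R {e})
  rcases isEmpty_or_nonempty (Module.Free.ChooseBasisIndex R (Submodule.span R {e})) with hι | ⟨⟨i⟩⟩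
  · left
    have : Subsingleton (Submodule.span R {e}) := b.repr.toEquiv.subsingleton
    exact congrArg Subtype.val
      (Subsingleton.elim (⟨e, Submodule.mem_span_singleton_self e⟩ : Submodule.span R {e}) 0)
  · right
    -- `1 - e` kills the ideal `(e)`, hence a basis vector of it, whose coordinate is `1`.
    have h : (1 - e) • b i = 0 := by
      ext
      simp [sub_mul, key _ (b i).2]
    have h' := congrArg (fun v => b.repr v i) h
    simp only [map_smul, Module.Basis.repr_self, map_zero, Finsupp.smul_apply,
      Finsupp.single_eq_same, Finsupp.zero_apply, smul_eq_mul, mul_one] at h'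
    exact (sub_eq_zero.1 h').symm

theorem mem_jacobson_matrix_iff {R : Type*} [CommRing R] {n : Type*} [Fintype n] [DecidableEq n]
    {M : Matrix n n R} :
    M ∈ Ring.jacobson (Matrix n n R) ↔ ∀ i j, M i j ∈ Ring.jacobson R := by
  have h := congrArg (fun I => M ∈ I) (TwoSidedIdeal.matrix_jacobson_bot (n := n) (R := R))
  rw [TwoSidedIdeal.mem_matrix] at h
  simp only [← TwoSidedIdeal.mem_asIdeal, TwoSidedIdeal.asIdeal_jacobson,
    TwoSidedIdeal.bot_asIdeal, Ideal.jacobson_bot] at h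
  exact (Iff.of_eq h).symm

theorem mem_jacobson_of_pow_mem {R : Type*} [CommRing R] {x : R} {n : ℕ}
    (h : x ^ n ∈ Ring.jacobson R) : x ∈ Ring.jacobson R := by
  rw [← Ideal.jacobson_bot] at h ⊢
  exact Ideal.isRadical_jacobson ⊥ ⟨n, h⟩

theorem isUnit_of_sub_one_mem_jacobson {R : Type*} [CommRing R] {x : R}
    (h : x - 1 ∈ Ring.jacobson R) : IsUnit x := by
  rw [← Ideal.jacobson_bot] at h
  simpa using Ideal.mem_jacobson_bot.1 h 1

theorem mem_jacobson_of_isNilpotent {R : Type*} [CommRing R] {x : R} (h : IsNilpotent x) :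
    x ∈ Ring.jacobson R :=
  nilradical_le_jacobson R h

/-- A nil kernel lies in the Jacobson radical. -/
theorem map_mem_jacobson_iff {T R : Type*} [CommRing T] [CommRing R] {f : T →+* R}
    (hf : Function.Surjective f) (hnil : ∀ x, f x = 0 → IsNilpotent x) {x : T} :
    f x ∈ Ring.jacobson R ↔ x ∈ Ring.jacobson T := by
  have : RingHomSurjective f := ⟨hf⟩
  have h := Module.comap_jacobson_of_ker_le (f := f.toSemilinearMap) hf
    (fun x hx => mem_jacobson_of_isNilpotent (hnil x hx))
  exact Iff.of_eq (congrArg (fun I => x ∈ I) h)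

theorem mapMatrix_mem_jsharp_iff {T R : Type u} [CommRing T] [CommRing R] {f : T →+* R}
    (hf : Function.Surjective f) (hnil : ∀ x, f x = 0 → IsNilpotent x)
    {n : Type} [Fintype n] [DecidableEq n] {A : Matrix n n T} :
    f.mapMatrix A ∈ jsharp (Matrix n n R) ↔ A ∈ jsharp (Matrix n n T) := by
  refine exists_congr fun k => and_congr_right fun _ => ?_
  rw [← map_pow, mem_jacobson_matrix_iff, mem_jacobson_matrix_iff]
  exact forall_congr' fun i => forall_congr' fun j => map_mem_jacobson_iff hf hnil

/-- Over a ring with trivial idempotents, a `2 × 2` idempotent is `0`, `1`, or of rank one. -/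
theorem idempotent_matrix_two {R : Type*} [CommRing R]
    (hR : ∀ e : R, IsIdempotentElem e → e = 0 ∨ e = 1)
    {E : Matrix (Fin 2) (Fin 2) R} (hE : IsIdempotentElem E) :
    E = 0 ∨ E = 1 ∨ (E.det = 0 ∧ E.trace = 1) := by
  have hdet : IsIdempotentElem E.det := by
    rw [IsIdempotentElem, ← Matrix.det_mul, hE.eq]
  -- Cayley-Hamilton, with `E * E` replaced by `E`.
  have hCH : E = E.trace • E - E.det • 1 := by
    nth_rw 1 [← hE.eq]
    ext i j
    fin_cases i <;> fin_cases j <;>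
      simp [Matrix.mul_apply, Matrix.trace_fin_two, Matrix.det_fin_two] <;> ring
  rcases hR _ hdet with h0 | h1
  · rw [h0, zero_smul, sub_zero] at hCH
    have htr : IsIdempotentElem E.trace := by
      have := congrArg Matrix.trace hCH
      rw [Matrix.trace_smul, smul_eq_mul] at this
      exact this.symm
    rcases hR _ htr with h | h
    · left
      rw [hCH, h, zero_smul]
    · exact Or.inr (Or.inr ⟨h0, h⟩)
  · right; left
    have hu : IsUnit E := (Matrix.isUnit_iff_isUnit_det E).2 (h1 ▸ isUnit_one)
    exact hu.mul_left_cancel (by rw [hE.eq, mul_one])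

/-- Modelled on `E = u vᵀ`, where `E M E = u (vᵀ M u) vᵀ`; in general the entrywise differences are
multiples of `det E`. -/
theorem mul_mul_eq_trace_smul {R : Type*} [CommRing R] {E : Matrix (Fin 2) (Fin 2) R}
    (hdet : E.det = 0) (M : Matrix (Fin 2) (Fin 2) R) :
    E * M * E = (E * M).trace • E := by
  rw [Matrix.det_fin_two] at hdet
  ext i j
  fin_cases i <;> fin_cases j <;>
    simp [Matrix.mul_apply, Matrix.trace_fin_two, Fin.sum_univ_two]
  · linear_combination (-M 1 1) * hdet
  · linear_combination (M 0 1) * hdet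
  · linear_combination (M 1 0) * hdet
  · linear_combination (-M 0 0) * hdet

theorem mul_eq_trace_smul_of_commute {R : Type*} [CommRing R] {E M : Matrix (Fin 2) (Fin 2) R}
    (hE : IsIdempotentElem E) (hdet : E.det = 0) (hc : E * M = M * E) :
    M * E = (E * M).trace • E := by
  rw [← mul_mul_eq_trace_smul hdet, hc, mul_assoc, hE.eq]

/-- Taking the trace of `N ^ k * E = c ^ k • E` gives `c ^ k ∈ J`, and `J` is radical. -/
theorem mem_jacobson_of_mul_eq_smul {R : Type u} [CommRing R] {n : Type} [Fintype n]
    [DecidableEq n] {N E : Matrix n n R} {c : R} (htr : E.trace = 1) (h : N * E = c • E)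
    (hN : N ∈ jsharp (Matrix n n R)) : c ∈ Ring.jacobson R := by
  obtain ⟨k, -, hk⟩ := hN
  have hpow : ∀ k : ℕ, N ^ k * E = c ^ k • E := by
    intro k
    induction k with
    | zero => simp
    | succ k ih => rw [pow_succ, mul_assoc, h, mul_smul_comm, ih, smul_smul, pow_succ']
  have hmem : N ^ k * E ∈ Ring.jacobson (Matrix n n R) := Ideal.mul_mem_right _ _ hk
  rw [mem_jacobson_matrix_iff] at hmem
  have htrace : (N ^ k * E).trace ∈ Ring.jacobson R :=
    Ideal.sum_mem _ fun i _ => hmem i i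
  rw [hpow, Matrix.trace_smul, htr, smul_eq_mul, mul_one] at htrace
  exact mem_jacobson_of_pow_mem htrace

/-- The characteristic equation `a² - (tr M) a + det M = 0` has a root `a ∈ 1 + J(R)` with
`tr M - a ∈ J(R)`, if `M - E` is in `J^#` for a commuting idempotent `E` of rank one. -/
theorem exists_root_of_rank_one {R : Type u} [CommRing R] {E M : Matrix (Fin 2) (Fin 2) R}
    (hE : IsIdempotentElem E) (hdet : E.det = 0) (htr : E.trace = 1) (hc : E * M = M * E)
    (hJ : M - E ∈ jsharp (Matrix (Fin 2) (Fin 2) R)) :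
    ∃ a : R, a ^ 2 - M.trace * a + M.det = 0 ∧ a - 1 ∈ Ring.jacobson R ∧
      M.trace - a ∈ Ring.jacobson R := by
  have hME := mul_eq_trace_smul_of_commute hE hdet hc
  have hE' := hE.one_sub
  have hdet' : (1 - E).det = 0 := by
    rw [Matrix.det_fin_two] at hdet ⊢
    rw [Matrix.trace_fin_two] at htr
    simp
    linear_combination hdet - htr
  have htr' : (1 - E).trace = 1 := by
    rw [Matrix.trace_sub, htr, Matrix.trace_one]
    norm_num
  have hc' : (1 - E) * M = M * (1 - E) := by rw [sub_mul, mul_sub, hc, one_mul, mul_one]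
  have hME' := mul_eq_trace_smul_of_commute hE' hdet' hc'
  have hβ : ((1 - E) * M).trace = M.trace - (E * M).trace := by
    rw [sub_mul, one_mul, Matrix.trace_sub]
  rw [hβ] at hME'
  refine ⟨(E * M).trace, ?_, ?_, ?_⟩
  · generalize (E * M).trace = a at hME
    have hCH : M * M - M.trace • M + M.det • 1 = 0 := by
      ext i j
      fin_cases i <;> fin_cases j <;>
        simp [Matrix.mul_apply, Matrix.trace_fin_two, Matrix.det_fin_two] <;> ring
    have h : (a ^ 2 - M.trace * a + M.det) • E = 0 := by
      have h0 := congrArg (· * E) hCH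
      simp only [add_mul, sub_mul, smul_mul_assoc, mul_assoc, hME, mul_smul_comm, one_mul,
        zero_mul, smul_smul] at h0
      rw [add_smul, sub_smul, pow_two, h0]
    have h1 := congrArg Matrix.trace h
    rwa [Matrix.trace_smul, htr, Matrix.trace_zero, smul_eq_mul, mul_one] at h1
  · refine mem_jacobson_of_mul_eq_smul htr ?_ hJ
    rw [sub_mul, hME, hE.eq, sub_smul, one_smul]
  · refine mem_jacobson_of_mul_eq_smul htr' ?_ hJ
    rw [sub_mul, hME', mul_sub, mul_one, hE.eq, sub_self, sub_zero]

/-- A `2 × 2` matrix whose characteristic polynomial has a root in `1 + J` and one in `J` is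
strongly `J^#`-clean. -/
theorem isStronglyJSharpClean_of_root {T : Type u} [CommRing T] {A : Matrix (Fin 2) (Fin 2) T}
    {a : T} (hroot : a ^ 2 - A.trace * a + A.det = 0) (ha : a - 1 ∈ Ring.jacobson T)
    (hb : A.trace - a ∈ Ring.jacobson T) : IsStronglyJSharpClean A := by
  obtain ⟨b, hbdef⟩ : ∃ b, b = A.trace - a := ⟨_, rfl⟩
  rw [← hbdef] at hb
  have hu : IsUnit (a - b) := isUnit_of_sub_one_mem_jacobson (by
    rw [sub_right_comm]
    exact Ideal.sub_mem _ ha hb)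
  obtain ⟨v, hv⟩ := hu.exists_left_inv
  -- Cayley-Hamilton, `(A - a)(A - b) = 0`; hence `(A - b) / (a - b)` is idempotent.
  have hsq : (A - b • 1) * (A - b • 1) = (a - b) • (A - b • 1) := by
    have hdet : A.det = a * b := by rw [hbdef]; linear_combination hroot
    have htr : A.trace = a + b := by rw [hbdef]; ring
    rw [Matrix.det_fin_two] at hdet
    rw [Matrix.trace_fin_two] at htr
    ext i j
    fin_cases i <;> fin_cases j <;> simp [Matrix.mul_apply, Fin.sum_univ_two]
    · linear_combination A 0 0 * htr - hdet
    · linear_combination A 0 1 * htr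
    · linear_combination A 1 0 * htr
    · linear_combination A 1 1 * htr - hdet
  -- Spectral decomposition `A = a F + b (1 - F)` with `F = v (A - b)`.
  have hA : A - v • (A - b • 1) = (a - 1) • (v • (A - b • 1)) + b • (1 - v • (A - b • 1)) := by
    have h : (a - b) • v • (A - b • (1 : Matrix (Fin 2) (Fin 2) T)) = A - b • 1 := by
      rw [smul_smul, mul_comm, hv, one_smul]
    rw [sub_smul, sub_eq_iff_eq_add] at h
    rw [sub_smul, one_smul, smul_sub b 1]
    rw [h]
    abel
  refine ⟨v • (A - b • 1), ?_, ⟨1, le_rfl, ?_⟩, ?_⟩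
  · rw [IsIdempotentElem, smul_mul_smul_comm, hsq, smul_smul, mul_assoc, hv, mul_one]
  · rw [pow_one, hA, mem_jacobson_matrix_iff]
    intro i j
    exact Ideal.add_mem _ (Ideal.mul_mem_right _ _ ha) (Ideal.mul_mem_right _ _ hb)
  · simp [sub_mul, mul_sub]

/-- For a surjection with nil kernel onto a ring with trivial idempotents, strong `J^#`-cleanness
of `2 × 2` matrices ascends and descends. -/
theorem isStronglyJSharpClean_mapMatrix_iff {T R : Type u} [CommRing T] [CommRing R]
    (hR : ∀ e : R, IsIdempotentElem e → e = 0 ∨ e = 1) {f : T →+* R}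
    (hf : Function.Surjective f) (hnil : ∀ x, f x = 0 → IsNilpotent x)
    (A : Matrix (Fin 2) (Fin 2) T) :
    IsStronglyJSharpClean A ↔ IsStronglyJSharpClean (f.mapMatrix A) := by
  constructor
  · rintro ⟨E, hE, hJ, hc⟩
    refine ⟨f.mapMatrix E, hE.map f.mapMatrix, ?_, ?_⟩
    · rwa [← map_sub, mapMatrix_mem_jsharp_iff hf hnil]
    · rw [← map_mul, hc, map_mul]
  rintro ⟨E, hE, hJ, hc⟩
  rcases idempotent_matrix_two hR hE with rfl | rfl | ⟨hdet, htr⟩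
  · refine ⟨0, IsIdempotentElem.zero, ?_, by simp⟩
    rwa [← map_zero f.mapMatrix, ← map_sub, mapMatrix_mem_jsharp_iff hf hnil] at hJ
  · refine ⟨1, IsIdempotentElem.one, ?_, by simp⟩
    rwa [← map_one f.mapMatrix, ← map_sub, mapMatrix_mem_jsharp_iff hf hnil] at hJ
  obtain ⟨α, hα, hα1, hαtr⟩ := exists_root_of_rank_one hE hdet htr hc hJ
  have htrA : (f.mapMatrix A).trace = f A.trace := by
    simp [Matrix.trace_fin_two]
  have hdetA : (f.mapMatrix A).det = f A.det := (f.map_det A).symm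
  rw [htrA] at hα hαtr
  rw [hdetA] at hα
  obtain ⟨x, rfl⟩ := hf α
  have hx1 : x - 1 ∈ Ring.jacobson T := by
    rwa [← map_mem_jacobson_iff hf hnil, map_sub, map_one]
  have hxtr : A.trace - x ∈ Ring.jacobson T := by
    rwa [← map_mem_jacobson_iff hf hnil, map_sub]
  let P : Polynomial T := Polynomial.X ^ 2 - Polynomial.C A.trace * Polynomial.X +
    Polynomial.C A.det
  have hP : ∀ t : T, Polynomial.aeval t P = t ^ 2 - A.trace * t + A.det := by
    intro t
    simp [P]
  have hP' : Polynomial.aeval x (Polynomial.derivative P) = x - (A.trace - x) := by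
    simp [P]
    ring
  -- Newton's method: `P(x)` is nilpotent and `P'(x)`, the difference of the approximate roots, lies
  -- in `1 + J`.
  obtain ⟨a, ⟨hxa, ha⟩, -⟩ := Polynomial.existsUnique_nilpotent_sub_and_aeval_eq_zero (P := P)
    (x := x) (by
      rw [hP]
      exact hnil _ (by simpa using hα))
    (by
      rw [hP']
      exact isUnit_of_sub_one_mem_jacobson (by
        rw [sub_right_comm]
        exact Ideal.sub_mem _ hx1 hxtr))
  have hxa' := mem_jacobson_of_isNilpotent hxa
  refine isStronglyJSharpClean_of_root ((hP a).symm.trans ha) ?_ ?_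
  · have := Ideal.sub_mem _ hx1 hxa'
    rwa [show x - 1 - (x - a) = a - 1 by ring] at this
  · have := Ideal.add_mem _ hxtr hxa'
    rwa [show A.trace - x + (x - a) = A.trace - a by ring] at this

theorem evalZero_surjective (R : Type u) [CommRing R] (m : ℕ) (hm : 1 ≤ m) :
    Function.Surjective (evalZero R m hm) := fun r =>
  ⟨Ideal.Quotient.mk _ (PowerSeries.C r), by simp [evalZero]⟩

theorem isNilpotent_of_evalZero_eq_zero {R : Type u} [CommRing R] {m : ℕ} {hm : 1 ≤ m}
    {x : TruncPowerSeries R m} (hx : evalZero R m hm x = 0) : IsNilpotent x := by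
  obtain ⟨g, rfl⟩ := Ideal.Quotient.mk_surjective x
  have hg : PowerSeries.constantCoeff g = 0 := by simpa [evalZero] using hx
  refine ⟨m, ?_⟩
  rw [← map_pow, Ideal.Quotient.eq_zero_iff_mem, Ideal.mem_span_singleton]
  exact pow_dvd_pow_of_dvd (PowerSeries.X_dvd_iff.2 hg) m

end JSharp

theorem corollary3p2 {R : Type u} [CommRing R] (hR : JSharp.IsProjectiveFree R)
    (m : ℕ) (hm : 1 ≤ m) (A : Matrix (Fin 2) (Fin 2) (JSharp.TruncPowerSeries R m)) :
    JSharp.IsStronglyJSharpClean A ↔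
      JSharp.IsStronglyJSharpClean (A.map (JSharp.evalZero R m hm)) :=
  JSharp.isStronglyJSharpClean_mapMatrix_iff (fun _ he => hR.eq_zero_or_eq_one he)
    (JSharp.evalZero_surjective R m hm) (fun _ hx => JSharp.isNilpotent_of_evalZero_eq_zero hx) A
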